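/- Let $\mathcal{G}$ be a Grothendieck category. For a regular cardinal $\mu$, a poset is called \emph{$\mu$-directed} if each of its subsets of cardinality less than $\mu$ has an upper bound; a \emph{$\mu$-direct limit} is a colimit of a directed system indexed by a (small) $\mu$-directed poset; and an object $M$ of $\mathcal{G}$ is \emph{$\mu$-presentable} if $\operatorname{Hom}_{\mathcal{G}}(M,-)$ preserves $\mu$-direct limits. Then there exists a regular cardinal $\mu$ such that every $\mu$-direct limit in $\mathcal{G}$ of injective objects is again injective, and there is a set (not a proper class) $T$ of injective objects of $\mathcal{G}$ that are $\mu$-presentable in $\mathcal{G}$, such that every injective object of $\mathcal{G}$ is a $\mu$-direct limit of objects from $T$. -/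

import Mathlib

open CategoryTheory Limits

universe v u

/-- A partially ordered set `J` is `μ`-directed if every subset of cardinality `< μ`
has an upper bound. (For `S = ∅` this says that `J` is nonempty.) -/
def IsCardinalDirected (J : Type v) [PartialOrder J] (μ : Cardinal.{v}) : Prop :=
  ∀ S : Set J, Cardinal.mk S < μ → BddAbove S

/-- `X` is a `μ`-direct limit of objects satisfying `P`: it is the colimit of a diagram of
such objects indexed by a (small) `μ`-directed partially ordered set. -/
def IsCardinalDirectLimitOf {C : Type u} [Category.{v} C] (μ : Cardinal.{v})
    (P : ObjectProperty C) (X : C) : Prop :=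
  ∃ (J : Type v) (_ : PartialOrder J), IsCardinalDirected J μ ∧
    ∃ (F : J ⥤ C) (c : Cocone F), Nonempty (IsColimit c) ∧ c.pt = X ∧ ∀ j, P (F.obj j)

/-- Being `μ`-directed is the same as being `μ`-filtered as a category. -/
theorem isCardinalDirected_iff_isCardinalFiltered (J : Type v) [PartialOrder J]
    (μ : Cardinal.{v}) [Fact μ.IsRegular] :
    IsCardinalDirected J μ ↔ IsCardinalFiltered J μ := by
  constructor
  · intro h
    refine isCardinalFiltered_preorder J μ (fun K f hK ↦ ?_)
    obtain ⟨b, hb⟩ := h (Set.range f) (Cardinal.mk_range_le.trans_lt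
      (by simpa [hasCardinalLT_iff_cardinal_mk_lt] using hK))
    exact ⟨b, fun i ↦ hb ⟨i, rfl⟩⟩
  · intro h S hS
    refine ⟨IsCardinalFiltered.max (κ := μ) (fun s : S ↦ (s : J))
      (by simpa [hasCardinalLT_iff_cardinal_mk_lt] using hS), ?_⟩
    intro s hs
    exact leOfHom (IsCardinalFiltered.toMax (κ := μ) (fun s : S ↦ (s : J)) _ ⟨s, hs⟩)

/-- The `μ`-direct limits of objects satisfying `P` agree with Mathlib's colimits of shape `J`. -/
theorem isCardinalDirectLimitOf_iff {C : Type u} [Category.{v} C] (μ : Cardinal.{v})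
    (P : ObjectProperty C) (X : C) :
    IsCardinalDirectLimitOf μ P X ↔
      ∃ (J : Type v) (_ : PartialOrder J), IsCardinalDirected J μ ∧ P.colimitsOfShape J X := by
  constructor
  · rintro ⟨J, _, hJ, F, c, ⟨hc⟩, rfl, hP⟩
    exact ⟨J, _, hJ, ⟨{ diag := F, ι := c.ι, isColimit := hc, prop_diag_obj := hP }⟩⟩
  · rintro ⟨J, _, hJ, ⟨p⟩⟩
    exact ⟨J, _, hJ, p.diag, _, ⟨p.isColimit⟩, rfl, p.prop_diag_obj⟩

/-! Fix a separator `G`, an infinite set `W` with at least as many elements as `Subobject G` and `G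
⟶ G`, and a sufficiently large `κ` with `κ ^ #W = κ`; the cardinal sought is `μ = κ⁺`. By
Gabriel–Popescu, an object receiving at most `κ` morphisms from `G` is `μ`-presentable
(`isCardinalPresentable_of_hasCardinalLT_hom`). This covers the subobjects of `G`, so Baer's
criterion passes to `μ`-direct limits of injectives.

The decomposition of an injective `E` is a Löwenheim–Skolem argument. At most `κ` morphisms `G ⟶ E`
generate a subobject receiving at most `κ` morphisms from `G`, and also from each subobject of `G`.
Adjoining extensions to `G` of all the latter, and iterating `(#W)⁺` times, yields an injective
subobject of the same size (`exists_superset_injective`). These subobjects form a `κ⁺`-directed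
system with union `E`, and up to isomorphism there is only a set of objects of this size. -/

section LatticeStabilization

universe w

/-- A monotone family of elements of a complete lattice of cardinality `< κ`, indexed by a
`κ`-filtered category, attains its supremum. -/
lemma exists_eq_iSup_of_isCardinalFiltered {J : Type u} [Category.{w} J] {κ : Cardinal.{v}}
    [Fact κ.IsRegular] [IsCardinalFiltered J κ] {L : Type*} [CompleteLattice L]
    (hL : HasCardinalLT L κ) (s : J → L) (hs : ∀ ⦃j j' : J⦄, (j ⟶ j') → s j ≤ s j') :
    ∃ j, s j = ⨆ i, s i := by
  have hr : HasCardinalLT (Set.range s) κ := hL.of_injective _ Subtype.val_injective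
  have h' : ∀ t : Set.range s, ∃ j, s j = t := fun t ↦ t.2
  choose σ hσ using h'
  refine ⟨IsCardinalFiltered.max σ hr, le_antisymm (le_iSup s _) (iSup_le fun i ↦ ?_)⟩
  have := hs (IsCardinalFiltered.toMax σ hr ⟨s i, i, rfl⟩)
  rwa [hσ] at this

end LatticeStabilization

namespace CategoryTheory.IsGrothendieckAbelian

lemma hasCardinalLT_subobject_of_mono {C : Type u} [Category.{v} C] [HasPullbacks C]
    {κ : Cardinal.{v}} {K X : C} (i : K ⟶ X) [Mono i]
    (h : HasCardinalLT (Subobject X) κ) : HasCardinalLT (Subobject K) κ :=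
  h.of_injective _ (Subobject.map_obj_injective i)

variable {C : Type u} [Category.{v} C] [Abelian C] [IsGrothendieckAbelian.{v} C]

lemma epi_desc_of_forall_exists {G : C} (hG : IsSeparator G) {X : C} {K : Type v} (φ : K → (G ⟶ X))
    (hφ : ∀ g : G ⟶ X, ∃ k, φ k = g) : Epi (Limits.Sigma.desc φ) := by
  refine ⟨fun a b hab ↦ hG.def _ _ fun g ↦ ?_⟩
  obtain ⟨k, rfl⟩ := hφ g
  simpa using Sigma.ι (fun _ : K ↦ G) k ≫= hab

/-! ### Every object is presentable. -/

section Presentable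

variable {X : C} {J : Type v} [SmallCategory J] {Y : J ⥤ C} {c : Cocone Y}

/-- A morphism to a `κ`-filtered colimit becomes a morphism to a term of the diagram after
composition with an epimorphism. -/
lemma exists_epi_comp_eq_comp_ι (hc : IsColimit c) {κ : Cardinal.{v}} [Fact κ.IsRegular]
    [IsCardinalFiltered J κ] (hX : HasCardinalLT (Subobject X) κ) (z : X ⟶ c.pt) :
    ∃ (j : J) (P : C) (e : P ⟶ X) (q : P ⟶ Y.obj j), Epi e ∧ q ≫ c.ι.app j = e ≫ z := by
  have := isFiltered_of_isCardinalFiltered J κ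
  let D := pullback c.ι ((Functor.const J).map z)
  let e : D ⟶ (Functor.const J).obj X := pullback.snd c.ι ((Functor.const J).map z)
  let q : D ⟶ Y := pullback.fst c.ι ((Functor.const J).map z)
  let s (j : J) : Subobject X := imageSubobject (X := D.obj j) (Y := X) (e.app j)
  have hs : ∀ ⦃j j' : J⦄, (j ⟶ j') → s j ≤ s j' := fun j j' φ ↦ by
    have h : e.app j = D.map φ ≫ e.app j' := by simp
    refine imageSubobject_le _ (D.map φ ≫ factorThruImageSubobject (Y := X) (e.app j')) ?_
    rw [Category.assoc, imageSubobject_arrow_comp, h]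
  -- By exactness of filtered colimits `colimit D ⟶ X` is an epimorphism, and it factors through the
  -- supremum of the images.
  have htop : ⨆ j, s j = ⊤ := by
    have hf : ∀ j, (⨆ j, s j).Factors (Y := X) (e.app j) := fun j ↦
      Subobject.factors_of_le _ (le_iSup s j)
        (by
          have := imageSubobject_factors_comp_self (X := D.obj j) (Y := X) (e.app j) (𝟙 (D.obj j))
          rwa [Category.id_comp] at this)
    have hi := IsPresentable.surjectivity.epi_f hc z
    have hn (j j' : J) (φ : j ⟶ j') :
        D.map φ ≫ (⨆ j, s j).factorThru (e.app j') (hf j') =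
          (⨆ j, s j).factorThru (e.app j) (hf j) := by
      rw [← cancel_mono (⨆ j, s j).arrow]
      simp
    let d : colimit D ⟶ ((⨆ j, s j : Subobject X) : C) := colimit.desc D
      { pt := _
        ι := { app := fun j ↦ (⨆ j, s j).factorThru (e.app j) (hf j)
               naturality := fun j j' φ ↦ (hn j j' φ).trans (Category.comp_id _).symm } }
    have hd : d ≫ (⨆ j, s j).arrow = IsPresentable.surjectivity.f z :=
      colimit.hom_ext fun j ↦ by
        rw [IsPresentable.surjectivity.hf]
        simp [d, e]
    have : Epi (⨆ j, s j).arrow := by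
      have : Epi (d ≫ (⨆ j, s j).arrow) := by rw [hd]; exact hi
      exact epi_of_epi d _
    rw [← Subobject.isIso_arrow_iff_eq_top]
    exact isIso_of_mono_of_epi _
  obtain ⟨j, hj⟩ := exists_eq_iSup_of_isCardinalFiltered hX s hs
  refine ⟨j, D.obj j, e.app j, q.app j, ?_, ?_⟩
  · have := (Subobject.isIso_arrow_iff_eq_top (s j)).2 (hj.trans htop)
    rw [← imageSubobject_arrow_comp (X := D.obj j) (Y := X) (e.app j)]
    exact epi_comp _ _
  · simpa using NatTrans.congr_app (pullback.condition (f := c.ι)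
      (g := (Functor.const J).map z)) j

/-- The cover `P` of `X` has uncontrolled size, so it is replaced by a coproduct of copies of `G`
depending only on `X`. The kernel of the new cover then has few subobjects, hence its map to the
diagram vanishes at a later stage and the lift descends to `X`. -/
lemma exists_hom_comp_ι_eq {G : C} (hG : IsSeparator G) (hc : IsColimit c) {κ : Cardinal.{v}}
    [Fact κ.IsRegular] [IsCardinalFiltered J κ] (hX : HasCardinalLT (Subobject X) κ)
    (hX' : HasCardinalLT (Subobject (∐ fun _ : G ⟶ X ↦ G)) κ) (z : X ⟶ c.pt) :
    ∃ (j : J) (y : X ⟶ Y.obj j), z = y ≫ c.ι.app j := by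
  classical
  obtain ⟨j, P, e, q, he, hq⟩ := exists_epi_comp_eq_comp_ι hc hX z
  -- Morphisms that do not lift along `e` are sent to `0`; those that lift already suffice for an
  -- epimorphism.
  let a : (∐ fun _ : G ⟶ X ↦ G) ⟶ P :=
    Limits.Sigma.desc fun h ↦ if H : ∃ t, t ≫ e = h then H.choose else 0
  have ha (t : G ⟶ P) : Sigma.ι (fun _ : G ⟶ X ↦ G) (t ≫ e) ≫ a ≫ e = t ≫ e := by
    have H : ∃ t', t' ≫ e = t ≫ e := ⟨t, rfl⟩
    simp only [a, Sigma.ι_desc_assoc]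
    rw [dif_pos H, H.choose_spec]
  have hae : Epi (a ≫ e) := ⟨fun b b' hb ↦ by
    rw [← cancel_epi e]
    refine hG.def _ _ fun t ↦ ?_
    have := Sigma.ι (fun _ : G ⟶ X ↦ G) (t ≫ e) ≫= hb
    simpa only [Category.assoc, reassoc_of% (ha t)] using this⟩
  obtain ⟨k, φ, hφ⟩ := IsPresentable.injectivity₀ hc
    (hasCardinalLT_subobject_of_mono (kernel.ι (a ≫ e)) hX') (kernel.ι (a ≫ e) ≫ a ≫ q) (by
      simp only [Category.assoc, hq]
      rw [← Category.assoc a, kernel.condition_assoc, zero_comp])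
  refine ⟨k, Abelian.epiDesc (a ≫ e) (a ≫ q ≫ Y.map φ) (by simpa using hφ), ?_⟩
  rw [← cancel_epi (a ≫ e), ← Category.assoc (a ≫ e) (Abelian.epiDesc _ _ _),
    Abelian.comp_epiDesc]
  simp [hq]

/-- Every object of a Grothendieck abelian category is presentable. -/
lemma exists_isCardinalPresentable (X : C) :
    ∃ (κ : Cardinal.{v}) (_ : Fact κ.IsRegular), IsCardinalPresentable X κ := by
  let G := separator C
  obtain ⟨κ, hκ, h⟩ := HasCardinalLT.exists_regular_cardinal_forall.{v}
    (fun b : Bool ↦ Subobject (if b then X else ∐ fun _ : G ⟶ X ↦ G))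
  have : Fact κ.IsRegular := ⟨hκ⟩
  refine ⟨κ, this, ⟨fun J _ _ ↦ ⟨fun {Y} ↦ ⟨fun {c} hc ↦ ⟨?_⟩⟩⟩⟩⟩
  have := isFiltered_of_isCardinalFiltered J κ
  exact Types.FilteredColimit.isColimitOf' _ _
    (exists_hom_comp_ι_eq (isSeparator_separator C) hc (h true) (h false))
    (IsPresentable.injectivity hc (h true))

end Presentable

/-! ### Presentability from counting morphisms out of the separator. -/

/-- If `G` is a separator which is `μ`-presentable, then any object `X` such that both `End G` and
`G ⟶ X` have cardinality `< μ` is `μ`-presentable. -/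
lemma isCardinalPresentable_of_hasCardinalLT_hom {G : C} (hG : IsSeparator G) {μ : Cardinal.{v}}
    [Fact μ.IsRegular] [IsCardinalPresentable G μ] (hEnd : HasCardinalLT (G ⟶ G) μ) {X : C}
    (hX : HasCardinalLT (G ⟶ X) μ) : IsCardinalPresentable X μ := by
  refine ⟨fun J _ _ ↦ ⟨fun {Y} ↦ ⟨fun {c} hc ↦ ⟨?_⟩⟩⟩⟩
  have := isFiltered_of_isCardinalFiltered J μ
  have hinj {ι : Type v} (hι : HasCardinalLT ι μ) {j : J} (a b : ι → (G ⟶ Y.obj j))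
      (hab : ∀ i, a i ≫ c.ι.app j = b i ≫ c.ι.app j) :
      ∃ (k : J) (φ : j ⟶ k), ∀ i, a i ≫ Y.map φ = b i ≫ Y.map φ := by
    choose k φ hφ using fun i ↦
      IsCardinalPresentable.exists_eq_of_isColimit' μ hc (a i) (b i) (hab i)
    obtain ⟨m, α, β, h⟩ := IsCardinalFiltered.wideSpan φ hι
    exact ⟨m, β, fun i ↦ by rw [← h i, Y.map_comp, reassoc_of% (hφ i)]⟩
  refine Types.FilteredColimit.isColimitOf' _ _ (fun z ↦ ?_) (fun j a b hab ↦ ?_)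
  · change X ⟶ c.pt at z
    have hprod := hasCardinalLT_prod (Fact.out : μ.IsRegular).aleph0_le hX hX
    have hprod' := hasCardinalLT_prod (Fact.out : μ.IsRegular).aleph0_le hEnd hX
    choose j₀ l₀ hl₀ using fun g : G ⟶ X ↦
      IsCardinalPresentable.exists_hom_of_isColimit μ hc (g ≫ z)
    let j₁ := IsCardinalFiltered.max j₀ hX
    let l₁ (g : G ⟶ X) : G ⟶ Y.obj j₁ := l₀ g ≫ Y.map (IsCardinalFiltered.toMax j₀ hX g)
    have hl₁ (g : G ⟶ X) : l₁ g ≫ c.ι.app j₁ = g ≫ z := by simp [l₁, hl₀]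
    -- The chosen lifts are additive and `End G`-linear only in the colimit. Fewer than `μ`
    -- identities are involved, so one later stage makes them all hold; fullness in Gabriel–Popescu
    -- then turns the linear map into a morphism.
    obtain ⟨j₂, φ₂, h₂⟩ := hinj hprod (fun g ↦ l₁ (g.1 + g.2)) (fun g ↦ l₁ g.1 + l₁ g.2)
      (fun g ↦ by simp [Preadditive.add_comp, hl₁])
    obtain ⟨j₃, φ₃, h₃⟩ := hinj hprod' (fun g ↦ l₁ (g.1 ≫ g.2) ≫ Y.map φ₂)
      (fun g ↦ (g.1 ≫ l₁ g.2) ≫ Y.map φ₂) (fun g ↦ by simp [hl₁])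
    have := GabrielPopescu.full G hG
    let L : (preadditiveCoyonedaObj G).obj X ⟶ (preadditiveCoyonedaObj G).obj (Y.obj j₃) :=
      ModuleCat.ofHom
        { toFun := fun g : G ⟶ X ↦ (l₁ g ≫ Y.map φ₂ ≫ Y.map φ₃ : G ⟶ Y.obj j₃)
          map_add' := fun g g' ↦ by
            have := h₂ (g, g')
            dsimp at this
            rw [reassoc_of% this]
            simp [Preadditive.add_comp]
          map_smul' := fun r g ↦ by
            have := h₃ (r.unop, g)
            change l₁ (r.unop ≫ g) ≫ Y.map φ₂ ≫ Y.map φ₃ = r.unop ≫ l₁ g ≫ Y.map φ₂ ≫ Y.map φ₃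
            simpa using this }
    obtain ⟨y, hy⟩ := (preadditiveCoyonedaObj G).map_surjective L
    refine ⟨j₃, y, hG.def _ _ fun g ↦ ?_⟩
    have hg : g ≫ y = l₁ g ≫ Y.map φ₂ ≫ Y.map φ₃ :=
      congr($(hy).hom g)
    change g ≫ z = g ≫ y ≫ c.ι.app j₃
    rw [reassoc_of% hg]
    simp [hl₁]
  · change X ⟶ Y.obj j at a b
    change a ≫ c.ι.app j = b ≫ c.ι.app j at hab
    obtain ⟨k, φ, h⟩ := hinj hX (fun g ↦ g ≫ a) (fun g ↦ g ≫ b) (fun g ↦ by simp [hab])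
    exact ⟨k, φ, hG.def _ _ fun g ↦ by simpa using h g⟩

/-! ### Baer's criterion and directed colimits of injectives. -/

/-- Baer's criterion for an object of a Grothendieck abelian category. -/
lemma injective_iff_exists_extension {G : C} (hG : IsSeparator G) (E : C) :
    Injective E ↔ ∀ (U : Subobject G) (f : (U : C) ⟶ E), ∃ g : G ⟶ E, U.arrow ≫ g = f := by
  refine ⟨fun _ U f ↦ ⟨Injective.factorThru f U.arrow, Injective.comp_factorThru f U.arrow⟩,
    fun h ↦ ?_⟩
  rw [injective_iff_rlp_monomorphisms_zero, ← generatingMonomorphisms_rlp hG]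
  rintro _ _ _ ⟨U⟩
  refine ⟨fun {t b} sq ↦ ?_⟩
  obtain ⟨g, hg⟩ := h U t
  exact ⟨⟨{ l := g, fac_left := hg, fac_right := (isZero_zero C).eq_of_tgt _ _ }⟩⟩

/-- A `μ`-filtered colimit of injective objects is injective if the separator and its subobjects
are `μ`-presentable. -/
lemma injective_of_isColimit {G : C} (hG : IsSeparator G) {μ : Cardinal.{v}}
    [Fact μ.IsRegular] (hU : ∀ U : Subobject G, IsCardinalPresentable (U : C) μ)
    {J : Type v} [SmallCategory J] [IsCardinalFiltered J μ]
    {F : J ⥤ C} {c : Cocone F} (hc : IsColimit c) (hF : ∀ j, Injective (F.obj j)) :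
    Injective c.pt := by
  rw [injective_iff_exists_extension hG]
  intro U f
  have := hU U
  have := hF
  obtain ⟨j, f', rfl⟩ := IsCardinalPresentable.exists_hom_of_isColimit μ hc f
  exact ⟨Injective.factorThru f' U.arrow ≫ c.ι.app j, by simp⟩

/-! ### Generated subobjects and directed unions. -/

open Cardinal

lemma imageSubobject_le_iff_factors {C : Type u} [Category.{v} C] [Abelian C] {A B : C} (f : A ⟶ B) (Y : Subobject B) :
    imageSubobject f ≤ Y ↔ Y.Factors f := by
  refine ⟨fun h ↦ Subobject.factors_of_le f h ?_, fun h ↦ imageSubobject_le f (Y.factorThru f h) ?_⟩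
  · have := imageSubobject_factors_comp_self f (𝟙 A)
    rwa [Category.id_comp] at this
  · simp

lemma subobject_le_of_forall_factors {G : C} (hG : IsSeparator G) {E : C} {P Q : Subobject E}
    (h : ∀ g : G ⟶ E, P.Factors g → Q.Factors g) : P ≤ Q := by
  have : IsIso (Subobject.ofLE _ _ (inf_le_left : P ⊓ Q ≤ P)) := by
    rw [hG.isDetector.isIso_iff_of_mono]
    rintro _ ⟨⟩ g
    have hg := (Subobject.inf_factors (g ≫ P.arrow)).2
      ⟨Subobject.factors_comp_arrow g, h _ (Subobject.factors_comp_arrow g)⟩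
    refine ⟨(P ⊓ Q).factorThru _ hg, ?_⟩
    rw [← cancel_mono P.arrow]
    simp
  have h' : P ≤ P ⊓ Q := Subobject.le_of_comm (inv (Subobject.ofLE _ _ inf_le_left)) (by simp)
  exact h'.trans inf_le_right

/-- The subobject of `E` generated by a set of morphisms to `E`. -/
noncomputable def generatedSubobject {G E : C} (S : Set (G ⟶ E)) : Subobject E :=
  ⨆ s : S, imageSubobject s.1

section

variable {G E : C}

lemma generatedSubobject_le_iff {S : Set (G ⟶ E)} {Y : Subobject E} :
    generatedSubobject S ≤ Y ↔ ∀ s ∈ S, Y.Factors s := by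
  simp [generatedSubobject, imageSubobject_le_iff_factors]

lemma generatedSubobject_factors {S : Set (G ⟶ E)} {s : G ⟶ E} (hs : s ∈ S) :
    (generatedSubobject S).Factors s :=
  generatedSubobject_le_iff.1 le_rfl s hs

lemma generatedSubobject_mono : Monotone (generatedSubobject (G := G) (E := E)) :=
  fun _ _ h ↦ generatedSubobject_le_iff.2 fun _ hs ↦ generatedSubobject_factors (h hs)

end

section

variable {E : C} {J : Type v} [Preorder J] {X : J → Subobject E} (hX : Monotone X)

/-- The diagram attached to a monotone family of subobjects. -/
noncomputable abbrev subobjectDiagram : J ⥤ C := hX.functor ⋙ Subobject.underlying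

/-- The cocone with point the supremum of a monotone family of subobjects. -/
noncomputable def subobjectCocone : Cocone (subobjectDiagram hX) where
  pt := ((⨆ j, X j : Subobject E) : C)
  ι :=
    { app j := Subobject.ofLE (X j) _ (le_iSup X j)
      naturality j j' φ := by
        rw [← cancel_mono (⨆ j, X j).arrow]
        simpa using Subobject.underlying_arrow (hX.functor.map φ) }

lemma nonempty_isColimit_subobjectCocone [IsFiltered J] :
    Nonempty (IsColimit (subobjectCocone hX)) := by
  let F : J ⥤ MonoOver E := hX.functor ⋙ Subobject.representative
  let c : Cocone (F ⋙ MonoOver.forget _) :=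
    { pt := Over.mk (⨆ j, X j).arrow
      ι :=
        { app j := Over.homMk (Subobject.ofLE (X j) _ (le_iSup X j)) (by
            exact Subobject.ofLE_arrow _)
          naturality j j' φ := by
            ext
            exact (subobjectCocone hX).ι.naturality φ } }
  have : Mono c.pt.hom := inferInstanceAs (Mono (⨆ j, X j).arrow)
  exact ⟨isColimitMapCoconeOfSubobjectMkEqISup F c (by
    trans ⨆ j, X j
    · exact Subobject.mk_arrow _
    · exact iSup_congr fun j ↦ (Subobject.mk_arrow (X j)).symm)⟩

-- Since the transition maps are monomorphisms, a bound on `Subobject U` alone suffices. This allows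
-- the cardinal `(#W)⁺`, which is at most `κ`.
include hX in
lemma exists_factors_of_iSup_factors {κ : Cardinal.{v}} [Fact κ.IsRegular]
    [IsCardinalFiltered J κ] {U : C} (hU : HasCardinalLT (Subobject U) κ) {f : U ⟶ E}
    (hf : (⨆ j, X j).Factors f) : ∃ j, (X j).Factors f := by
  have := isFiltered_of_isCardinalFiltered J κ
  have hm (j j' : J) (φ : j ⟶ j') : Mono ((subobjectDiagram hX).map φ) :=
    have : Mono ((subobjectDiagram hX).map φ ≫ (X j').arrow) := by
      rw [show (subobjectDiagram hX).map φ ≫ (X j').arrow = (X j).arrow from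
        Subobject.underlying_arrow (hX.functor.map φ)]
      exact (inferInstance : Mono (X j).arrow)
    mono_of_mono _ (X j').arrow
  obtain ⟨j, y, hy⟩ := IsPresentable.surjectivity (nonempty_isColimit_subobjectCocone hX).some hU
    ((⨆ j, X j).factorThru f hf)
  have hf' : f = (show U ⟶ (X j : C) from y) ≫ (X j).arrow := by
    have := hy =≫ (⨆ j, X j).arrow
    rw [Subobject.factorThru_arrow] at this
    exact this.trans ((Category.assoc _ _ _).trans (y ≫= Subobject.ofLE_arrow (le_iSup X j)))
  exact ⟨j, hf' ▸ Subobject.factors_comp_arrow _⟩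

end

lemma exists_iso_cokernel_subobject {C : Type u} [Category.{v} C] [Abelian C] {Q X : C}
    (p : Q ⟶ X) [Epi p] : ∃ S : Subobject Q, Nonempty (X ≅ cokernel S.arrow) := by
  refine ⟨kernelSubobject p, ⟨?_⟩⟩
  let e : cokernel (kernelSubobject p).arrow ≅ cokernel (kernel.ι p) :=
    cokernel.mapIso _ _ (kernelSubobjectIso p) (Iso.refl _) (by simp)
  exact (Abelian.epiIsCokernelOfKernel _ (kernelIsKernel p)).coconePointUniqueUpToIso
    (cokernelIsCokernel (kernel.ι p)) ≪≫ e.symm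

/-! ### Cardinal bounds. -/

/-- A cardinal `κ` which is large with respect to the number of subobjects and endomorphisms of `G`,
and such that quotients of the coproduct of `#W` copies of `G` receive at most `κ` morphisms
from `G`. -/
structure IsBoundingCardinal (G : C) (W : Type v) (κ : Cardinal.{v}) : Prop where
  aleph0_le : ℵ₀ ≤ #W
  hasCardinalLT_subobject : HasCardinalLT (Subobject G) (Order.succ #W)
  mk_end_le : #(G ⟶ G) ≤ #W
  pow_eq : κ ^ #W = κ
  mk_lt : #W < κ
  mk_hom_le ⦃X : C⦄ (p : (∐ fun _ : W ↦ G) ⟶ X) [Epi p] : #(G ⟶ X) ≤ κ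

/-- Taking a power with infinite exponent `#W` forces `κ ^ #W = κ`. The base contains `2` for
Cantor's inequality and `c` to bound the morphisms into all quotients of `Q` at once. -/
lemma exists_isBoundingCardinal (G : C) (κ₀ : Cardinal.{v}) :
    ∃ (W : Type v) (κ : Cardinal.{v}), κ₀ ≤ κ ∧ IsBoundingCardinal G W κ := by
  let W := ULift.{v} ℕ ⊕ Shrink.{v} (Subobject G) ⊕ (G ⟶ G)
  let Q := ∐ fun _ : W ↦ G
  let c : Cardinal.{v} :=
    #(Σ S : Shrink.{v} (Subobject Q), (G ⟶ cokernel ((equivShrink _).symm S).arrow))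
  have hW : ℵ₀ ≤ #W := by
    simp only [W, mk_sum, mk_uLift, mk_nat, lift_aleph0, lift_id]
    exact self_le_add_right _ _
  have hκ : max 2 (max κ₀ c) ≤ max 2 (max κ₀ c) ^ #W :=
    self_le_power _ (one_le_aleph0.trans hW)
  refine ⟨W, (max 2 (max κ₀ c)) ^ #W, ?_, hW, ?_, ?_, ?_, ?_, ?_⟩
  · exact (le_max_left _ _).trans ((le_max_right _ _).trans hκ)
  · rw [hasCardinalLT_iff_of_equiv (equivShrink.{v} (Subobject G)),
      hasCardinalLT_iff_cardinal_mk_lt, Order.lt_succ_iff]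
    exact mk_le_of_injective (f := fun x ↦ Sum.inr (Sum.inl x))
      (Sum.inr_injective.comp Sum.inl_injective)
  · exact mk_le_of_injective (f := fun x ↦ Sum.inr (Sum.inr x))
      (Sum.inr_injective.comp Sum.inr_injective)
  · rw [← power_mul, mul_eq_self hW]
  · exact (cantor _).trans_le (power_le_power_right (le_max_left _ _))
  · intro X p _
    obtain ⟨S, ⟨e⟩⟩ := exists_iso_cokernel_subobject p
    refine le_trans ?_ ((le_max_right _ _).trans ((le_max_right _ _).trans hκ))
    refine mk_le_of_injective (f := fun g ↦ ⟨equivShrink _ S,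
      g ≫ e.hom ≫ eqToHom (by rw [Equiv.symm_apply_apply])⟩) fun g g' h ↦ ?_
    simpa only [Sigma.mk.injEq, heq_eq_eq, true_and, cancel_mono] using h

lemma hasCardinalLT_succ_iff {X : Type v} {κ : Cardinal.{v}} :
    HasCardinalLT X (Order.succ κ) ↔ #X ≤ κ := by
  rw [hasCardinalLT_iff_cardinal_mk_lt, Order.lt_succ_iff]

lemma mk_iUnion_le_of_le {α ι : Type v} {κ : Cardinal.{v}} (hκ : ℵ₀ ≤ κ) (hι : #ι ≤ κ)
    (f : ι → Set α) (hf : ∀ i, #(f i) ≤ κ) : #(⋃ i, f i) ≤ κ :=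
  (mk_iUnion_le f).trans ((mul_le_mul' hι (ciSup_le' hf)).trans (mul_eq_self hκ).le)

namespace IsBoundingCardinal

variable {G : C} {W : Type v} {κ : Cardinal.{v}} (h : IsBoundingCardinal G W κ)
include h

lemma aleph0_le_right : ℵ₀ ≤ κ := h.aleph0_le.trans h.mk_lt.le

lemma isRegular_succ : (Order.succ #W).IsRegular := Cardinal.isRegular_succ h.aleph0_le

lemma isRegular_succ_right : (Order.succ κ).IsRegular :=
  Cardinal.isRegular_succ h.aleph0_le_right

lemma mk_factors_image_le {E : C} (φ : W → (G ⟶ E)) :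
    #{f : G ⟶ E | (imageSubobject (Limits.Sigma.desc φ)).Factors f} ≤ κ := by
  refine le_trans ?_ (h.mk_hom_le (factorThruImageSubobject (Limits.Sigma.desc φ)))
  refine mk_le_of_injective (f := fun f ↦ Subobject.factorThru _ f.1 f.2) fun f g hfg ↦ ?_
  ext
  simpa using hfg =≫ (imageSubobject (Limits.Sigma.desc φ)).arrow

lemma mk_factors_generatedSubobject_le_of_mk_le {E : C} (B : Set (G ⟶ E)) (hB : #B ≤ #W) :
    #{f : G ⟶ E | (generatedSubobject B).Factors f} ≤ κ := by
  obtain ⟨e⟩ := hB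
  classical
  let φ (w : W) : G ⟶ E := if H : ∃ b, e b = w then H.choose.1 else 0
  have hφ (b : B) : φ (e b) = b.1 := by
    have H : ∃ b', e b' = e b := ⟨b, rfl⟩
    simp only [φ, dif_pos H, e.injective H.choose_spec]
  have hle : generatedSubobject B ≤ imageSubobject (Limits.Sigma.desc φ) := by
    rw [generatedSubobject_le_iff]
    intro b hb
    have := imageSubobject_factors_comp_self (Limits.Sigma.desc φ) (Limits.Sigma.ι _ (e ⟨b, hb⟩))
    rwa [Sigma.ι_desc, hφ] at this
  exact (mk_le_mk_of_subset fun f hf ↦ Subobject.factors_of_le f hle hf).trans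
    (h.mk_factors_image_le φ)

/-- A subobject generated by at most `κ` morphisms receives at most `κ` morphisms. -/
lemma mk_factors_generatedSubobject_le {E : C} (S : Set (G ⟶ E)) (hS : #S ≤ κ) :
    #{f : G ⟶ E | (generatedSubobject S).Factors f} ≤ κ := by
  have : Fact (Order.succ #W).IsRegular := ⟨h.isRegular_succ⟩
  -- There are at most `κ ^ #W = κ` such pieces and they are `(#W)⁺`-directed, so each morphism from
  -- `G` factors through one of them.
  let J := { B : Set (G ⟶ E) // B ⊆ S ∧ #B ≤ #W }
  have hJ : #J ≤ κ := by
    refine (mk_bounded_subset_le S #W).trans ?_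
    conv_rhs => rw [← h.pow_eq]
    exact power_le_power_right (max_le hS h.aleph0_le_right)
  have : IsCardinalFiltered J (Order.succ #W) :=
    isCardinalFiltered_preorder _ _ fun K s hK ↦
      ⟨⟨⋃ k, (s k).1, Set.iUnion_subset fun k ↦ (s k).2.1,
        mk_iUnion_le_of_le h.aleph0_le (Order.lt_succ_iff.1 hK) _ fun k ↦ (s k).2.2⟩,
        fun k ↦ Set.subset_iUnion (fun k ↦ (s k).1) k⟩
  have hX : Monotone fun B : J ↦ generatedSubobject B.1 := fun B B' hB ↦ generatedSubobject_mono hB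
  have hS' : generatedSubobject S ≤ ⨆ B : J, generatedSubobject B.1 := by
    rw [generatedSubobject_le_iff]
    intro s hs
    let B : J := ⟨{s}, by simpa using hs, by simpa using one_le_aleph0.trans h.aleph0_le⟩
    exact Subobject.factors_of_le _ (le_iSup (fun B : J ↦ generatedSubobject B.1) B)
      (generatedSubobject_factors rfl)
  refine (mk_le_mk_of_subset (t := ⋃ B : J, {f | (generatedSubobject B.1).Factors f})
    fun f hf ↦ ?_).trans (mk_iUnion_le_of_le h.aleph0_le_right hJ _ fun B ↦
      h.mk_factors_generatedSubobject_le_of_mk_le B.1 B.2.2)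
  rw [Set.mem_iUnion]
  exact exists_factors_of_iSup_factors hX h.hasCardinalLT_subobject
    (Subobject.factors_of_le f hS' hf)

lemma mk_hom_generatedSubobject_le {E : C} (S : Set (G ⟶ E)) (hS : #S ≤ κ) :
    #(G ⟶ (generatedSubobject S : C)) ≤ κ := by
  refine le_trans ?_ (h.mk_factors_generatedSubobject_le S hS)
  refine mk_le_of_injective (f := fun f ↦ ⟨f ≫ (generatedSubobject S).arrow,
    Subobject.factors_comp_arrow f⟩) fun f g hfg ↦ ?_
  simpa [cancel_mono] using congrArg Subtype.val hfg

lemma mk_hom_subobject_le (U : Subobject G) : #(G ⟶ (U : C)) ≤ #W := by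
  refine le_trans ?_ h.mk_end_le
  exact mk_le_of_injective (f := fun f ↦ f ≫ U.arrow) fun f g hfg ↦ (cancel_mono U.arrow).1 hfg

/-- A morphism from `U` is determined by its composites with the at most `#W` morphisms `G ⟶ U`,
whence the bound `κ ^ #W = κ`. -/
lemma mk_factors_from_subobject_le (hG : IsSeparator G) {E : C} (S : Set (G ⟶ E)) (hS : #S ≤ κ)
    (U : Subobject G) : #{f : (U : C) ⟶ E | (generatedSubobject S).Factors f} ≤ κ := by
  let F : {f : (U : C) ⟶ E | (generatedSubobject S).Factors f} →
      ((G ⟶ (U : C)) → {f : G ⟶ E | (generatedSubobject S).Factors f}) := fun f g ↦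
    ⟨g ≫ f.1, Subobject.factors_of_factors_right g
      (show (generatedSubobject S).Factors f.1 from f.2)⟩
  have hF : Function.Injective F := fun f f' hff ↦ by
    ext
    exact hG.def _ _ fun g ↦ congrArg Subtype.val (congrFun hff g)
  refine (mk_le_of_injective hF).trans ?_
  rw [← power_def]
  conv_rhs => rw [← h.pow_eq]
  refine (power_le_power_right (h.mk_factors_generatedSubobject_le S hS)).trans ?_
  exact power_le_power_left (aleph0_pos.trans_le h.aleph0_le_right).ne' (h.mk_hom_subobject_le U)

/-! ### Small injective subobjects. -/

/-- Enlarging a generating set in order to extend morphisms from subobjects of `G`. -/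
lemma exists_superset_extension (hG : IsSeparator G) {E : C} [Injective E] (S : Set (G ⟶ E)) :
    ∃ S' : Set (G ⟶ E), S ⊆ S' ∧ (#S ≤ κ → #S' ≤ κ) ∧
      ∀ (U : Subobject G) (f : (U : C) ⟶ E), (generatedSubobject S).Factors f →
        ∃ g ∈ S', U.arrow ≫ g = f := by
  let V (U : Shrink.{v} (Subobject G)) : Subobject G := (equivShrink _).symm U
  let A (U : Shrink.{v} (Subobject G)) : Set (G ⟶ E) :=
    Set.range fun f : {f : (V U : C) ⟶ E | (generatedSubobject S).Factors f} ↦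
      Injective.factorThru f.1 (V U).arrow
  refine ⟨S ∪ ⋃ U, A U, Set.subset_union_left, fun hS ↦ ?_, fun U f hf ↦ ?_⟩
  · refine (mk_union_le _ _).trans (add_le_of_le h.aleph0_le_right hS
      (mk_iUnion_le_of_le h.aleph0_le_right ?_ _ fun U ↦
        mk_range_le.trans (h.mk_factors_from_subobject_le hG S hS (V U))))
    have := h.hasCardinalLT_subobject
    rw [hasCardinalLT_iff_of_equiv (equivShrink.{v} (Subobject G)), hasCardinalLT_succ_iff] at this
    exact this.trans h.mk_lt.le
  · obtain ⟨U, rfl⟩ := (equivShrink.{v} (Subobject G)).symm.surjective U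
    exact ⟨_, Or.inr (Set.mem_iUnion.2 ⟨U, ⟨f, hf⟩, rfl⟩), Injective.comp_factorThru _ _⟩

/-- Every small set of morphisms to an injective object is contained in a small set generating
an injective subobject. -/
lemma exists_superset_injective (hG : IsSeparator G) {E : C} [Injective E] (S : Set (G ⟶ E))
    (hS : #S ≤ κ) : ∃ S' : Set (G ⟶ E), S ⊆ S' ∧ #S' ≤ κ ∧
      Injective (generatedSubobject S' : C) := by
  -- The size bound is conditional, so `enl` is defined on all sets and the recursion needs no
  -- simultaneous size estimate.
  choose enl le_enl mk_enl exists_enl using h.exists_superset_extension hG (E := E)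
  have : Fact (Order.succ #W).IsRegular := ⟨h.isRegular_succ⟩
  -- Long enough for morphisms from subobjects of `G` to factor at a stage, short enough that `#I ≤
  -- κ`.
  let I := (Order.succ #W).ord.ToType
  have hI : #I ≤ κ := by simpa [I] using Order.succ_le_of_lt h.mk_lt
  have : NoMaxOrder I := Cardinal.noMaxOrder h.isRegular_succ.aleph0_le
  have : Nonempty I := (IsCardinalFiltered.nonempty I (Order.succ #W))
  let T : I → Set (G ⟶ E) := WellFoundedLT.fix fun i T ↦ S ∪ ⋃ j : Set.Iio i, enl (T j.1 j.2)
  have hT (i : I) : T i = S ∪ ⋃ j : Set.Iio i, enl (T j.1) := WellFoundedLT.fix_eq _ _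
  have hTS (i : I) : S ⊆ T i := by rw [hT]; exact Set.subset_union_left
  have hTT {i j : I} (hij : j < i) : enl (T j) ⊆ T i := by
    rw [hT i]
    exact (Set.subset_iUnion (fun j : Set.Iio i ↦ enl (T j.1)) ⟨j, hij⟩).trans
      Set.subset_union_right
  have hmono : Monotone T := monotone_iff_forall_lt.2 fun j i hij ↦ (le_enl _).trans (hTT hij)
  have hcard (i : I) : #(T i) ≤ κ := by
    induction i using WellFoundedLT.induction with
    | ind i ih =>
      rw [hT]
      refine (mk_union_le _ _).trans (add_le_of_le h.aleph0_le_right hS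
        (mk_iUnion_le_of_le h.aleph0_le_right ((mk_set_le _).trans hI) _
          fun j ↦ mk_enl _ (ih j.1 j.2)))
  obtain ⟨i₀⟩ := ‹Nonempty I›
  refine ⟨⋃ i, T i, (hTS i₀).trans (Set.subset_iUnion T i₀),
    mk_iUnion_le_of_le h.aleph0_le_right hI _ hcard, ?_⟩
  rw [injective_iff_exists_extension hG]
  intro U f
  have hle : generatedSubobject (⋃ i, T i) ≤ ⨆ i, generatedSubobject (T i) := by
    rw [generatedSubobject_le_iff]
    intro s hs
    obtain ⟨i, hi⟩ := Set.mem_iUnion.1 hs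
    exact Subobject.factors_of_le _ (le_iSup (fun i ↦ generatedSubobject (T i)) i)
      (generatedSubobject_factors hi)
  obtain ⟨i, hi⟩ := exists_factors_of_iSup_factors (generatedSubobject_mono.comp hmono)
    (hasCardinalLT_subobject_of_mono U.arrow h.hasCardinalLT_subobject)
    (Subobject.factors_of_le _ hle (Subobject.factors_comp_arrow f))
  obtain ⟨g, hg, hgf⟩ := exists_enl _ U _ hi
  obtain ⟨j, hj⟩ := exists_gt i
  refine ⟨Subobject.factorThru _ g
    (generatedSubobject_factors (Set.mem_iUnion.2 ⟨j, hTT hj hg⟩)), ?_⟩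
  rw [← cancel_mono (generatedSubobject _).arrow]
  simpa using hgf

/-- An injective object is a `κ⁺`-directed union of injective subobjects which receive at
most `κ` morphisms from `G`. -/
lemma isCardinalDirectLimitOf (hG : IsSeparator G) (E : C) [Injective E] :
    IsCardinalDirectLimitOf (Order.succ κ)
      (fun X ↦ Injective X ∧ #(G ⟶ X) ≤ κ : ObjectProperty C) E := by
  -- Indexing by generating sets rather than by subobjects keeps `J` in `Type v`.
  let J := { S : Set (G ⟶ E) // #S ≤ κ ∧ Injective (generatedSubobject S : C) }
  have : Fact (Order.succ κ).IsRegular := ⟨h.isRegular_succ_right⟩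
  have hJ : IsCardinalFiltered J (Order.succ κ) :=
    isCardinalFiltered_preorder _ _ fun K s hK ↦ by
      obtain ⟨S', h₁, h₂, h₃⟩ := h.exists_superset_injective hG (⋃ k, (s k).1)
        (mk_iUnion_le_of_le h.aleph0_le_right (Order.lt_succ_iff.1 hK) _ fun k ↦ (s k).2.1)
      exact ⟨⟨S', h₂, h₃⟩, fun k ↦ (Set.subset_iUnion (fun k ↦ (s k).1) k).trans h₁⟩
  have := isFiltered_of_isCardinalFiltered J (Order.succ κ)
  have hX : Monotone fun S : J ↦ generatedSubobject S.1 := fun S S' hS ↦ generatedSubobject_mono hS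
  have htop : ⨆ S : J, generatedSubobject S.1 = ⊤ := by
    rw [← top_le_iff]
    refine subobject_le_of_forall_factors hG fun g _ ↦ ?_
    obtain ⟨S, h₁, h₂, h₃⟩ := h.exists_superset_injective hG {g}
      (by simpa using one_le_aleph0.trans h.aleph0_le_right)
    exact Subobject.factors_of_le _ (le_iSup (fun S : J ↦ generatedSubobject S.1) ⟨S, h₂, h₃⟩)
      (generatedSubobject_factors (h₁ rfl))
  let f : (subobjectCocone hX).pt ⟶ E := (⨆ S : J, generatedSubobject S.1).arrow
  have : IsIso f := (Subobject.isIso_arrow_iff_eq_top _).2 htop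
  obtain ⟨hc⟩ := nonempty_isColimit_subobjectCocone hX
  refine ⟨J, inferInstance, (isCardinalDirected_iff_isCardinalFiltered _ _).2 hJ,
    subobjectDiagram hX, (subobjectCocone hX).extend f, ⟨hc.extendIso _⟩, rfl, fun S ↦ ⟨S.2.2, h.mk_hom_generatedSubobject_le S.1 S.2.1⟩⟩

end IsBoundingCardinal

/-! ### Essential smallness and conclusion. -/

/-- The objects which receive at most `κ` morphisms from a separator form an essentially small
class. -/
lemma essentiallySmall_mk_hom_le {G : C} (hG : IsSeparator G) (κ : Cardinal.{v}) :
    ObjectProperty.EssentiallySmall.{v} (fun X ↦ #(G ⟶ X) ≤ κ : ObjectProperty C) := by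
  let Q := ∐ fun _ : κ.out ↦ G
  refine ⟨ObjectProperty.ofObj fun S : Shrink.{v} (Subobject Q) ↦
    cokernel ((equivShrink _).symm S).arrow, inferInstance, fun X hX ↦ ?_⟩
  rw [← mk_out κ] at hX
  obtain ⟨e⟩ := hX
  -- The left inverse of `e` lists every morphism `G ⟶ X`, so `X` is a quotient of `Q`.
  have : Epi (Limits.Sigma.desc (Function.invFun e)) :=
    epi_desc_of_forall_exists hG _ fun g ↦ ⟨e g, Function.leftInverse_invFun e.injective g⟩
  obtain ⟨S, ⟨i⟩⟩ := exists_iso_cokernel_subobject (Limits.Sigma.desc (Function.invFun e))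
  obtain ⟨S, rfl⟩ := (equivShrink.{v} (Subobject Q)).symm.surjective S
  exact ⟨_, ⟨S⟩, ⟨i⟩⟩

/-- Needed because a small `T` contains the terms of the directed system only up to isomorphism. -/
lemma isCardinalDirectLimitOf_of_le_isoClosure {C : Type u} [Category.{v} C] {μ : Cardinal.{v}}
    {P Q : ObjectProperty C} (h : P ≤ Q.isoClosure) {X : C} (hX : IsCardinalDirectLimitOf μ P X) :
    IsCardinalDirectLimitOf μ Q X := by
  rw [isCardinalDirectLimitOf_iff] at hX ⊢
  obtain ⟨J, _, hJ, hX⟩ := hX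
  refine ⟨J, _, hJ, ?_⟩
  rw [← ObjectProperty.colimitsOfShape_isoClosure]
  exact ObjectProperty.colimitsOfShape_monotone _ h _ hX

end CategoryTheory.IsGrothendieckAbelian

open IsGrothendieckAbelian in
theorem mainTheorem8 (C : Type u) [Category.{v} C] [Abelian C] [IsGrothendieckAbelian.{v} C] :
    ∃ (μ : Cardinal.{v}) (_ : Fact μ.IsRegular),
      (∀ X : C, IsCardinalDirectLimitOf μ (isInjective C) X → Injective X) ∧
      ∃ T : ObjectProperty C, ObjectProperty.Small.{v} T ∧
        (∀ E : C, T E → IsCardinalPresentable E μ ∧ Injective E) ∧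
        (∀ E : C, Injective E → IsCardinalDirectLimitOf μ T E) := by
  have hG := isSeparator_separator C
  obtain ⟨κ₀, _, _⟩ := exists_isCardinalPresentable (separator C)
  obtain ⟨W, κ, hκ₀, h⟩ := exists_isBoundingCardinal (separator C) κ₀
  have : Fact (Order.succ κ).IsRegular := ⟨h.isRegular_succ_right⟩
  have : IsCardinalPresentable (separator C) (Order.succ κ) :=
    isCardinalPresentable_of_le _ (hκ₀.trans (Order.le_succ κ))
  have hpres (X : C) (hX : Cardinal.mk (separator C ⟶ X) ≤ κ) :
      IsCardinalPresentable X (Order.succ κ) :=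
    isCardinalPresentable_of_hasCardinalLT_hom hG
      (hasCardinalLT_succ_iff.2 (h.mk_end_le.trans h.mk_lt.le)) (hasCardinalLT_succ_iff.2 hX)
  refine ⟨Order.succ κ, ⟨h.isRegular_succ_right⟩, ?_, ?_⟩
  · rintro _ ⟨J, _, hJ, F, c, ⟨hc⟩, rfl, hF⟩
    have := (isCardinalDirected_iff_isCardinalFiltered _ _).1 hJ
    exact injective_of_isColimit hG
      (fun U ↦ hpres _ ((h.mk_hom_subobject_le U).trans h.mk_lt.le)) hc hF
  · let P : ObjectProperty C := fun X ↦ Injective X ∧ Cardinal.mk (separator C ⟶ X) ≤ κ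
    have := essentiallySmall_mk_hom_le hG κ
    have : ObjectProperty.EssentiallySmall.{v} P :=
      ObjectProperty.EssentiallySmall.of_le (fun X hX ↦ hX.2)
    obtain ⟨T, hT, hTP, hPT⟩ := ObjectProperty.EssentiallySmall.exists_small_le P
    exact ⟨T, hT, fun E hE ↦ ⟨hpres E (hTP E hE).2, (hTP E hE).1⟩,
      fun E hE ↦ isCardinalDirectLimitOf_of_le_isoClosure hPT (h.isCardinalDirectLimitOf hG E)⟩
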